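/- Let $K$ be an algebraically closed field of characteristic $2$ and let $n\ge 0$. Let $$\Pi=\Pi_{2n+1}=\begin{pmatrix}0&0&1_n\\0&1&0\\1_n&0&0\end{pmatrix},\qquad \mathfrak o_\Pi(2n+1)=\{X\in\mathfrak{gl}(2n+1,K):\ X^{t}\Pi+\Pi X=0\},$$ and let $\mathfrak g=\mathfrak o^{(1)}_\Pi(2n+1)=[\mathfrak o_\Pi(2n+1),\mathfrak o_\Pi(2n+1)]$ be its derived algebra. Grade $\mathfrak g$ by giving the matrix unit $E^{a,b}$ the degree $d_a-d_b$, where $(d_1,\dots,d_{2n+1})=(n,n-1,\dots,1,0,-n,\dots,-1)$; this is the grading in which the positive (resp. negative) Chevalley generators, i.e. $E^{i,i+1}+E^{n+2+i,n+1+i}$ for $1\le i<n$ and $E^{n,n+1}+E^{n+1,2n+1}$ (resp. their transposes), have degree $1$ (resp. $-1$). A cochain $\mathfrak g\to\mathfrak g$ has weight $w$ if it raises degrees by $w$. (1) $\dim H^1(\mathfrak g;\mathfrak g)=2n$, and $H^1(\mathfrak g;\mathfrak g)$ has a basis consisting of the classes of $2n$ cocycles, exactly one of each of the weights $-2n,-2n+2,\dots,-2,\,2,\dots,2n-2,2n$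 (all nonzero even integers of absolute value at most $2n$). (2) The Lie algebra $\mathfrak{aut}(\mathfrak g)$ of all derivations of $\mathfrak g$ is $\mathfrak o_\Pi(2n+1)$ acting on its ideal $\mathfrak g$ by commutators, the scalar matrices acting by zero: the center of $\mathfrak o_\Pi(2n+1)$ is $K\cdot 1_{2n+1}$, and $X\mapsto [X,\cdot\,]|_{\mathfrak g}$ induces an isomorphism of Lie algebras $$\mathfrak o_\Pi(2n+1)/K\cdot 1_{2n+1}\;\xrightarrow{\ \sim\ }\;\mathfrak{aut}(\mathfrak g).$$ -/

import Mathlib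

open LieModule.Cohomology

attribute [local instance 100] LieRing.ofAssociativeRing

/-- Lie algebra 0-cochains to 1-cochains: `m ↦ (x ↦ ⁅x, m⁆)`. -/
def lieD01 (K L M : Type*) [CommRing K] [LieRing L] [LieAlgebra K L] [AddCommGroup M]
    [Module K M] [LieRingModule L M] [LieModule K L M] : M →ₗ[K] oneCochain K L M where
  toFun m :=
    { toFun := fun x => ⁅x, m⁆
      map_add' := fun x y => add_lie x y m
      map_smul' := fun t x => smul_lie t x m }
  map_add' a b := by ext x; exact lie_add x a b
  map_smul' t a := by ext x; exact lie_smul t x a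

/-- The space `Z¹(L; M)` of 1-cocycles, the kernel of the differential on 1-cochains. -/
def lieZ1 (K L M : Type*) [CommRing K] [LieRing L] [LieAlgebra K L] [AddCommGroup M]
    [Module K M] [LieRingModule L M] [LieModule K L M] : Submodule K (oneCochain K L M) :=
  LinearMap.ker (d₁₂ K L M)

/-- The space `B¹(L; M)` of 1-coboundaries. -/
def lieB1 (K L M : Type*) [CommRing K] [LieRing L] [LieAlgebra K L] [AddCommGroup M]
    [Module K M] [LieRingModule L M] [LieModule K L M] : Submodule K (oneCochain K L M) :=
  LinearMap.range (lieD01 K L M)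

theorem lieB1_le_lieZ1 (K L M : Type*) [CommRing K] [LieRing L] [LieAlgebra K L]
    [AddCommGroup M] [Module K M] [LieRingModule L M] [LieModule K L M] :
    lieB1 K L M ≤ lieZ1 K L M := by
  rintro _ ⟨m, rfl⟩
  refine LinearMap.mem_ker.mpr ?_
  ext x y
  change ⁅x, ⁅y, m⁆⁆ - ⁅y, ⁅x, m⁆⁆ - ⁅⁅x, y⁆, m⁆ = 0
  rw [lie_lie, sub_self]

/-- The first cohomology space `H¹(L; M) = Z¹(L; M) / B¹(L; M)`. -/
abbrev lieH1 (K L M : Type*) [CommRing K] [LieRing L] [LieAlgebra K L] [AddCommGroup M]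
    [Module K M] [LieRingModule L M] [LieModule K L M] : Type _ :=
  (lieZ1 K L M) ⧸ (lieB1 K L M).submoduleOf (lieZ1 K L M)

/-- The class in `H¹(L; M)` of a 1-cocycle. -/
def lieH1Mk (K L M : Type*) [CommRing K] [LieRing L] [LieAlgebra K L] [AddCommGroup M]
    [Module K M] [LieRingModule L M] [LieModule K L M] : lieZ1 K L M →ₗ[K] lieH1 K L M :=
  ((lieB1 K L M).submoduleOf (lieZ1 K L M)).mkQ

/-- Row and column labels of matrices of size `2n + 1`, in three blocks of sizes `n, 1, n`. -/
abbrev PiIndex (n : ℕ) : Type := Fin n ⊕ Unit ⊕ Fin n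

/-- The Gram matrix `Π_{2n+1}`: it has the blocks `1_n, 1, 1_n` on the antidiagonal and zeros
elsewhere. -/
def piMatrix (K : Type*) [CommRing K] (n : ℕ) : Matrix (PiIndex n) (PiIndex n) K :=
  Matrix.of fun a b =>
    match a, b with
    | Sum.inl i, Sum.inr (Sum.inr j) => if i = j then 1 else 0
    | Sum.inr (Sum.inl _), Sum.inr (Sum.inl _) => 1
    | Sum.inr (Sum.inr i), Sum.inl j => if i = j then 1 else 0
    | _, _ => 0

/-- `𝔬_Π(2n+1)`: the Lie algebra of all matrices `X` with `Xᵀ Π + Π X = 0`, i.e. preserving the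
symmetric bilinear form with Gram matrix `Π_{2n+1}`. -/
abbrev orthPi (K : Type*) [CommRing K] (n : ℕ) :
    LieSubalgebra K (Matrix (PiIndex n) (PiIndex n) K) :=
  skewAdjointMatricesLieSubalgebra (piMatrix K n)

/-- The derived algebra `𝔬_Π^{(1)}(2n+1) = [𝔬_Π(2n+1), 𝔬_Π(2n+1)]`. -/
abbrev orthPiDerived (K : Type*) [CommRing K] (n : ℕ) : LieIdeal K (orthPi K n) :=
  LieAlgebra.derivedSeries K (orthPi K n) 1

/-- The degrees `n, n-1, …, 1`, `0`, `-n, …, -1` of the standard basis vectors, in the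
order of the blocks. -/
def piWeight (n : ℕ) : PiIndex n → ℤ
  | Sum.inl i => (n : ℤ) - (i : ℤ)
  | Sum.inr (Sum.inl _) => 0
  | Sum.inr (Sum.inr i) => (i : ℤ) - (n : ℤ)

/-- The matrix `X` is homogeneous of degree `d` when the matrix unit `E^{a,b}` is given the degree
`piWeight a - piWeight b`. On `𝔬_Π^{(1)}(2n+1)` this is the grading in which each positive
Chevalley generator, `E^{i,i+1} + E^{n+1+(i+1),n+1+i}` for `1 ≤ i < n` and
`E^{n,n+1} + E^{n+1,2n+1}`, has degree `1` and each negative one, its transpose, has degree `-1`.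
The zero matrix is homogeneous of every degree. -/
def piHomogeneous {K : Type*} [CommRing K] {n : ℕ} (X : Matrix (PiIndex n) (PiIndex n) K)
    (d : ℤ) : Prop :=
  ∀ a b, X a b ≠ 0 → piWeight n a - piWeight n b = d

/-- The 1-cochain `c` of `𝔬_Π^{(1)}(2n+1)` with values in the adjoint module has weight `w`: it
sends homogeneous elements of degree `d` to homogeneous elements of degree `d + w`. -/
def CochainHasWeight {K : Type*} [CommRing K] {n : ℕ}
    (c : oneCochain K (orthPiDerived K n) (orthPiDerived K n)) (w : ℤ) : Prop :=
  ∀ (x : orthPiDerived K n) (d : ℤ),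
    piHomogeneous (x : Matrix (PiIndex n) (PiIndex n) K) d →
      piHomogeneous (c x : Matrix (PiIndex n) (PiIndex n) K) (d + w)

/-!
In characteristic two `Π` is the Gram matrix of a symmetric form that is not alternating, so it has
an orthonormal basis: an explicit one (`piFrame`) is obtained by repeatedly splitting
`⟨1⟩ ⊕ hyperbolic plane` as `⟨1⟩ ⊕ ⟨1⟩ ⊕ ⟨1⟩`. In this basis `𝔬_Π(2n+1)` becomes the Lie algebra
of all symmetric matrices and its derived algebra `𝔤` becomes the symmetric matrices with zero
diagonal, spanned by `z_{ab} = E_{ab} + E_{ba}` with `[z_{ac}, z_{cb}] = z_{ab}` for distinct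
`a, b, c` (`mem_derived_iff_diag_conj`).

A derivation `D` of `𝔤` is determined by the matrices `D z_{ab}`, and the Leibniz rule for
`[z_{ac}, z_{cb}] = z_{ab}`, read off entry by entry, forces `D z_{ab} = [S, z_{ab}]` for one
symmetric matrix `S` (`exists_symm_of_leibniz`). The argument needs a fifth index besides any four
distinct ones, which exists because `2n + 1` is odd. As only scalar matrices commute with all
`z_{ab}`, the algebra of derivations is `𝔬_Π(2n+1)` modulo scalars.

For the cohomology, 1-cocycles are derivations and coboundaries are inner derivations. An element
`X` of `𝔬_Π(2n+1)` lies in `𝔤` exactly when the diagonal of `Π X` vanishes (`mem_derived_iff`), and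
scalar matrices change only the middle entry of this diagonal. Hence the other `2n` diagonal entries
are coordinates on `H¹(𝔤; 𝔤)`, and the dual basis consists of the classes of the commutators with
the matrix units `E^{a',a}`, where `a'` is the label opposite to `a`. The degree of `E^{a',a}` is
`d_{a'} - d_a = -2 d_a`, and these numbers are the nonzero even integers of absolute value at most
`2n`.
-/

open Matrix

/-! ### Symmetric and alternating matrices in characteristic two -/

theorem diag_lie_of_symm {ι K : Type*} [Fintype ι] [CommRing K] {S T : Matrix ι ι K}
    (hS : Sᵀ = S) (hT : Tᵀ = T) (a : ι) : (S * T - T * S) a a = 0 := by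
  have h : (S * T)ᵀ = T * S := by rw [transpose_mul, hS, hT]
  rw [← h, Matrix.sub_apply, transpose_apply, sub_self]

section MatrixUnits

variable {ι K : Type*} [DecidableEq ι] [CommRing K]

/-- The symmetric matrix `E_{ab} + E_{ba}`. For `a ≠ b` these span the space of
symmetric matrices with zero diagonal (the alternating matrices in characteristic two). -/
def symUnit (K : Type*) [CommRing K] (a b : ι) : Matrix ι ι K := single a b 1 + single b a 1

theorem symUnit_comm (a b : ι) : symUnit K a b = symUnit K b a := add_comm _ _

theorem symUnit_transpose (a b : ι) : (symUnit K a b)ᵀ = symUnit K a b := by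
  simp [symUnit, add_comm]

variable [Fintype ι]

theorem mul_symUnit_apply (M : Matrix ι ι K) (a b x y : ι) :
    (M * symUnit K a b) x y = (if y = b then M x a else 0) + (if y = a then M x b else 0) := by
  simp only [symUnit, mul_add, Matrix.add_apply]
  congr 1 <;> split_ifs with h
  · subst h; simp
  · exact mul_single_apply_of_ne _ _ _ _ _ h _
  · subst h; simp
  · exact mul_single_apply_of_ne _ _ _ _ _ h _

theorem symUnit_mul_apply (M : Matrix ι ι K) (a b x y : ι) :
    (symUnit K a b * M) x y = (if x = a then M b y else 0) + (if x = b then M a y else 0) := by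
  simp only [symUnit, add_mul, Matrix.add_apply]
  congr 1 <;> split_ifs with h
  · subst h; simp
  · exact single_mul_apply_of_ne _ _ _ _ _ h _
  · subst h; simp
  · exact single_mul_apply_of_ne _ _ _ _ _ h _

/-- A symmetric matrix with zero diagonal is a combination of the matrices `E_{ab} + E_{ba}`. -/
theorem mem_span_symUnit {Z : Matrix ι ι K} (hs : Zᵀ = Z) (hd : ∀ a, Z a a = 0) :
    Z ∈ Submodule.span K {M | ∃ a b : ι, a ≠ b ∧ M = symUnit K a b} := by
  classical
  let _ : LinearOrder ι := LinearOrder.lift' (Fintype.equivFin ι) (Fintype.equivFin ι).injective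
  have hs' : ∀ x y, Z x y = Z y x := fun x y => congrFun (congrFun hs y) x
  have key : Z = ∑ a, ∑ b, if a < b then Z a b • symUnit K a b else 0 := by
    ext x y
    have hterm : ∀ a b, (if a < b then Z a b • symUnit K a b else 0) x y =
        (if a = x then (if b = y then (if x < y then Z x y else 0) else 0) else 0) +
        (if a = y then (if b = x then (if y < x then Z x y else 0) else 0) else 0) := by
      intro a b
      by_cases hab : a < b
      · simp only [hab, if_true, symUnit, Matrix.smul_apply, Matrix.add_apply, single_apply,
          smul_eq_mul]
        have := hs' x y
        grind
      · simp only [hab, if_false, Matrix.zero_apply]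
        grind
    simp only [Matrix.sum_apply, hterm, Finset.sum_add_distrib]
    simp only [Finset.sum_ite_irrel, Finset.sum_const_zero, Finset.sum_ite_eq', Finset.mem_univ,
      if_true]
    rcases lt_trichotomy x y with h | h | h
    · simp [h, h.not_gt]
    · simp [h, hd]
    · simp [h, h.not_gt]
  rw [key]
  refine Submodule.sum_mem _ fun a _ => Submodule.sum_mem _ fun b _ => ?_
  split_ifs with h
  · exact Submodule.smul_mem _ _ (Submodule.subset_span ⟨a, b, h.ne, rfl⟩)
  · exact Submodule.zero_mem _

/-- A symmetric matrix commuting with all alternating ones is scalar, except in size two. -/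
theorem exists_eq_smul_one_of_commute_symUnit
    (h3 : ∀ a b : ι, a ≠ b → ∃ c, c ≠ a ∧ c ≠ b) {S : Matrix ι ι K}
    (hS : ∀ a b : ι, a ≠ b → S * symUnit K a b = symUnit K a b * S) :
    ∃ t : K, S = t • 1 := by
  rcases isEmpty_or_nonempty ι with hι | ⟨⟨o⟩⟩
  · exact ⟨0, Subsingleton.elim _ _⟩
  have he : ∀ a b, a ≠ b → ∀ x y, _ := fun a b hab x y => congrFun (congrFun (hS a b hab) x) y
  simp only [mul_symUnit_apply, symUnit_mul_apply] at he
  have hdiag : ∀ a, S a a = S o o := by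
    intro a
    by_cases hao : a = o
    · rw [hao]
    · simpa [hao, Ne.symm hao] using he a o hao a o
  have hoff : ∀ a b, a ≠ b → S a b = 0 := by
    intro a b hab
    obtain ⟨c, hca, hcb⟩ := h3 a b hab
    simpa [hab, hca, hcb, hab.symm, hca.symm, hcb.symm] using he b c hcb.symm a c
  refine ⟨S o o, ?_⟩
  ext x y
  by_cases hxy : x = y
  · subst hxy; simp [hdiag]
  · simp [hxy, hoff x y hxy]

variable [CharP K 2]

/-- Congruence preserves the alternating matrices. -/
theorem diag_congr_eq_zero {Z : Matrix ι ι K} (hs : Zᵀ = Z) (hd : ∀ a, Z a a = 0)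
    (P : Matrix ι ι K) (a : ι) : (Pᵀ * Z * P) a a = 0 := by
  have hZ := mem_span_symUnit hs hd
  clear hs hd
  induction hZ using Submodule.span_induction with
  | mem M hM =>
    obtain ⟨x, y, -, rfl⟩ := hM
    rw [Matrix.mul_apply]
    simp only [mul_symUnit_apply, add_mul, ite_mul, zero_mul, Finset.sum_add_distrib,
      Finset.sum_ite_eq', Finset.mem_univ, if_true, transpose_apply]
    rw [mul_comm, CharTwo.add_self_eq_zero]
  | zero => simp
  | add M N _ _ hM hN => rw [mul_add, add_mul, Matrix.add_apply, hM, hN, add_zero]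
  | smul t M _ hM => rw [mul_smul_comm, smul_mul_assoc, Matrix.smul_apply, hM, smul_zero]

/-- This exhibits the alternating matrices as commutators of symmetric ones. -/
theorem lie_single_symUnit {a b : ι} (hab : a ≠ b) :
    ⁅(single a a 1 : Matrix ι ι K), symUnit K a b⁆ = symUnit K a b := by
  ext x y
  rw [Ring.lie_def, Matrix.sub_apply, mul_symUnit_apply, symUnit_mul_apply, symUnit,
    Matrix.add_apply]
  simp only [single_apply, CharTwo.sub_eq_add]
  grind

theorem symUnit_eq_lie {a b c : ι} (hab : a ≠ b) (hbc : b ≠ c) (hac : a ≠ c) :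
    ⁅symUnit K a c, symUnit K c b⁆ = symUnit K a b := by
  ext x y
  rw [Ring.lie_def, Matrix.sub_apply, mul_symUnit_apply, symUnit_mul_apply]
  simp only [symUnit, Matrix.add_apply, single_apply, CharTwo.sub_eq_add]
  grind

/-- The heart of the computation of the derivations. A family `F a b` of alternating matrices
satisfying the Leibniz identities that correspond to `[z_{ac}, z_{cb}] = z_{ab}`, where
`z_{ab} = E_{ab} + E_{ba}`, is given by commutators with a symmetric matrix `S`. The entries of
`F a b` away from rows and columns `a`, `b` vanish, which needs a fifth index; the remaining
entries off `(a, b)` and `(b, a)` are off-diagonal entries of `S`; and the entries at `(a, b)` form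
a cocycle `t_{ab} = t_{ac} + t_{cb}`, whose primitive is the diagonal of `S`. -/
theorem exists_symm_of_leibniz (h3 : ∀ a b : ι, a ≠ b → ∃ c, c ≠ a ∧ c ≠ b)
    (h5 : ∀ a b c d : ι, a ≠ b → a ≠ c → a ≠ d → b ≠ c → b ≠ d → c ≠ d →
      ∃ e, e ≠ a ∧ e ≠ b ∧ e ≠ c ∧ e ≠ d)
    (F : ι → ι → Matrix ι ι K) (hcomm : ∀ a b, F a b = F b a)
    (hsymm : ∀ a b, (F a b)ᵀ = F a b) (hdiag : ∀ a b c, F a b c c = 0)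
    (hF : ∀ a b c, a ≠ b → b ≠ c → a ≠ c →
      F a b = ⁅F a c, symUnit K c b⁆ + ⁅symUnit K a c, F c b⁆) :
    ∃ S : Matrix ι ι K, Sᵀ = S ∧ ∀ a b, a ≠ b → F a b = ⁅S, symUnit K a b⁆ := by
  rcases isEmpty_or_nonempty ι with hι | ⟨⟨o⟩⟩
  · exact ⟨0, by simp, fun a => isEmptyElim a⟩
  have hs : ∀ a b x y, F a b x y = F a b y x := fun a b x y =>
    congrFun (congrFun (hsymm a b) y) x
  have he : ∀ a b c, a ≠ b → b ≠ c → a ≠ c → ∀ x y, _ := fun a b c h1 h2 h3 x y =>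
    congrFun (congrFun (hF a b c h1 h2 h3) x) y
  simp only [Ring.lie_def, Matrix.add_apply, Matrix.sub_apply, mul_symUnit_apply,
    symUnit_mul_apply, CharTwo.sub_eq_add] at he
  -- an index `e` outside `{a, b, x, y}` makes every term of the Leibniz identity vanish at `(x, y)`
  have hfar : ∀ a b x y, a ≠ b → x ≠ y → x ≠ a → x ≠ b → y ≠ a → y ≠ b → F a b x y = 0 := by
    intro a b x y hab hxy hxa hxb hya hyb
    obtain ⟨e, e1, e2, e3, e4⟩ := h5 a b x y hab hxa.symm hya.symm hxb.symm hyb.symm hxy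
    rw [he a b e hab e2.symm e1.symm x y]
    simp [hxa, hxb, hya, hyb, e3.symm, e4.symm]
  -- the coefficient with which `a` is moved to `c` does not depend on the other index `b`
  have hindep : ∀ a b b' c, a ≠ b → a ≠ b' → a ≠ c → c ≠ b → c ≠ b' →
      F a b c b = F a b' c b' := by
    intro a b b' c hab hab' hac hcb hcb'
    by_cases hbb : b = b'
    · rw [hbb]
    rw [he a b b' hab hbb hab' c b]
    simp [hac.symm, hcb, hcb', hbb, hab.symm]
  -- symmetry in `a` and `c`: the moved-to index `c` itself serves as the intermediate one
  have hswap : ∀ a b c, a ≠ b → a ≠ c → c ≠ b → F a b c b = F c b a b := by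
    intro a b c hab hac hcb
    rw [he a b c hab hcb.symm hac c b]
    simp [hac.symm, hcb, hcb.symm, hab.symm, hdiag]
  have hcocycle : ∀ a b c, a ≠ b → b ≠ c → a ≠ c → F a b a b = F a c a c + F c b c b := by
    intro a b c hab hbc hac
    rw [he a b c hab hbc hac a b]
    simp [hab, hab.symm, hac, hbc]
  obtain ⟨S, hSs, hSd, hSo⟩ : ∃ S : Matrix ι ι K, (∀ x y, S x y = S y x) ∧
      (∀ a b, a ≠ b → F a b a b = S a a + S b b) ∧
      ∀ a b c, a ≠ b → a ≠ c → c ≠ b → F a b c b = S c a := by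
    choose! β hβ1 hβ2 using h3
    -- the diagonal of `S` is normalised to vanish at the base point `o`
    let S : Matrix ι ι K := Matrix.of fun x y =>
      if x = y then (if x = o then 0 else F x o x o) else F y (β x y) x (β x y)
    have hSd : ∀ x, S x x = if x = o then 0 else F x o x o := fun x => by simp [S]
    have hSo : ∀ a b c, a ≠ b → a ≠ c → c ≠ b → F a b c b = S c a := by
      intro a b c hab hac hcb
      have hca := hac.symm
      rw [show S c a = F a (β c a) c (β c a) by simp [S, hca]]
      exact hindep _ _ _ _ hab (hβ2 _ _ hca).symm hac hcb (hβ1 _ _ hca).symm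
    refine ⟨S, fun x y => ?_, fun a b hab => ?_, hSo⟩
    · by_cases hxy : x = y
      · rw [hxy]
      have h1 := hβ1 x y hxy
      have h2 := hβ2 x y hxy
      rw [← hSo y (β x y) x h2.symm (Ne.symm hxy) h1.symm,
        ← hSo x (β x y) y h1.symm hxy h2.symm]
      exact hswap _ _ _ h2.symm (Ne.symm hxy) h1.symm
    · rw [hSd, hSd]
      by_cases hao : a = o
      · subst hao
        rw [if_pos rfl, if_neg hab.symm, zero_add, hcomm, hs]
      · by_cases hbo : b = o
        · subst hbo
          rw [if_pos rfl, if_neg hab, add_zero]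
        · rw [if_neg hao, if_neg hbo, hcocycle a b o hab hbo hao, hcomm o b, hs b o o b]
  refine ⟨S, by ext x y; exact hSs y x, fun a b hab => ?_⟩
  ext x y
  rw [Ring.lie_def, Matrix.sub_apply, mul_symUnit_apply, symUnit_mul_apply, CharTwo.sub_eq_add]
  have h2 : ∀ t : K, t + t = 0 := CharTwo.add_self_eq_zero
  by_cases hxy : x = y
  · subst hxy
    rw [hdiag]
    by_cases hxa : x = a
    · subst hxa
      simp [hab, hSs b x, h2]
    · by_cases hxb : x = b
      · subst hxb
        simp [hxa, hSs a x, h2]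
      · simp [hxa, hxb]
  by_cases hxa : x = a
  · subst hxa
    by_cases hyb : y = b
    · subst hyb
      simp [hSd, hab, Ne.symm hab]
    · rw [hcomm, hs, hSo b x y hab.symm (Ne.symm hyb) (Ne.symm hxy)]
      simp [hab, hyb, Ne.symm hxy, hSs y b]
  by_cases hxb : x = b
  · subst hxb
    by_cases hya : y = a
    · subst hya
      rw [hs, hSd y x hab, add_comm]
      simp [hab, Ne.symm hab]
    · rw [hs, hSo a x y hab (Ne.symm hya) (Ne.symm hxy)]
      simp [hya, hxa, Ne.symm hxy, hSs y a]
  by_cases hya : y = a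
  · subst hya
    rw [hcomm, hSo b y x hab.symm (Ne.symm hxb) hxa]
    simp [hxa, hxb, hab]
  by_cases hyb : y = b
  · subst hyb
    rw [hSo a y x hab (Ne.symm hxa) hxb]
    simp [hxa, hxb, hya]
  rw [hfar a b x y hab hxy hxa hxb hya hyb]
  simp [hxa, hxb, hya, hyb]

end MatrixUnits

/-! ### Orthogonal Lie algebras of forms with an orthonormal basis -/

section Orthonormal

variable {ι K : Type*} [Fintype ι] [DecidableEq ι] [CommRing K]
  {J A B : Matrix ι ι K}

theorem conj_conj (hAB : A * B = 1) (Z : Matrix ι ι K) : A * (B * Z * A) * B = Z := by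
  simp only [← Matrix.mul_assoc]
  rw [hAB, Matrix.one_mul, Matrix.mul_assoc, hAB, Matrix.mul_one]

theorem conj_lie (hBA : B * A = 1) (X Y : Matrix ι ι K) :
    A * ⁅X, Y⁆ * B = ⁅A * X * B, A * Y * B⁆ := by
  have h : ∀ X Y : Matrix ι ι K, A * X * B * (A * Y * B) = A * (X * Y) * B := by
    intro X Y
    calc A * X * B * (A * Y * B) = A * X * (B * A) * Y * B := by simp only [Matrix.mul_assoc]
      _ = _ := by rw [hBA, Matrix.mul_one, Matrix.mul_assoc A X Y]
  rw [Ring.lie_def, Ring.lie_def, h, h, mul_sub, sub_mul]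

variable [CharP K 2]

theorem mem_skewAdjoint_iff_of_charTwo (X : Matrix ι ι K) :
    X ∈ skewAdjointMatricesLieSubalgebra J ↔ Xᵀ * J = J * X := by
  have hneg : -X = X := by ext; simp [CharTwo.neg_eq]
  rw [mem_skewAdjointMatricesLieSubalgebra, mem_skewAdjointMatricesSubmodule,
    Matrix.IsSkewAdjoint, Matrix.IsAdjointPair, hneg]

/-- A factorization `J = Aᵀ A` with `A` invertible, of inverse `B`, encodes an orthonormal basis for
the form with Gram matrix `J`, in which `X` has the matrix `A X B`. There the skew-adjoint matrices
are the symmetric ones. -/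
theorem mem_skewAdjoint_iff_symm (hAB : A * B = 1) (hBA : B * A = 1) (hJ : J = Aᵀ * A)
    (X : Matrix ι ι K) :
    X ∈ skewAdjointMatricesLieSubalgebra J ↔ (A * X * B)ᵀ = A * X * B := by
  have hBA' : Aᵀ * Bᵀ = 1 := by rw [← transpose_mul, hBA, transpose_one]
  have hAB' : Bᵀ * Aᵀ = 1 := by rw [← transpose_mul, hAB, transpose_one]
  rw [mem_skewAdjoint_iff_of_charTwo, hJ]
  simp only [transpose_mul, ← Matrix.mul_assoc]
  constructor
  · intro h
    calc Bᵀ * Xᵀ * Aᵀ = Bᵀ * (Xᵀ * Aᵀ * A) * B := by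
          rw [← Matrix.mul_assoc, ← Matrix.mul_assoc, Matrix.mul_assoc _ A, hAB, Matrix.mul_one]
      _ = A * X * B := by
          rw [h]
          simp only [← Matrix.mul_assoc]
          rw [hAB', Matrix.one_mul]
  · intro h
    calc Xᵀ * Aᵀ * A = Aᵀ * (Bᵀ * Xᵀ * Aᵀ) * A := by
          simp only [← Matrix.mul_assoc]
          rw [hBA', Matrix.one_mul]
      _ = Aᵀ * A * X := by
          rw [h]
          simp only [← Matrix.mul_assoc]
          rw [Matrix.mul_assoc _ B, hBA, Matrix.mul_one]

/-- The derived algebra consists of the matrices that are alternating in an orthonormal basis. -/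
theorem mem_derived_iff_diag_conj (hAB : A * B = 1) (hBA : B * A = 1) (hJ : J = Aᵀ * A)
    (X : skewAdjointMatricesLieSubalgebra J) :
    X ∈ LieAlgebra.derivedSeries K (skewAdjointMatricesLieSubalgebra J) 1 ↔
      ∀ a, (A * (X : Matrix ι ι K) * B) a a = 0 := by
  have hmem := mem_skewAdjoint_iff_symm hAB hBA hJ
  rw [LieAlgebra.derivedSeries_def, LieAlgebra.derivedSeriesOfIdeal_succ,
    LieAlgebra.derivedSeriesOfIdeal_zero]
  constructor
  · intro hX a
    rw [← LieSubmodule.mem_toSubmodule, LieSubmodule.lieIdeal_oper_eq_linear_span'] at hX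
    induction hX using Submodule.span_induction with
    | mem Y hY =>
      obtain ⟨S, -, T, -, rfl⟩ := hY
      change (A * ⁅(S : Matrix ι ι K), (T : Matrix ι ι K)⁆ * B) a a = 0
      rw [conj_lie hBA, Ring.lie_def]
      exact diag_lie_of_symm ((hmem _).1 S.2) ((hmem _).1 T.2) a
    | zero => simp
    | add Y Z _ _ hY hZ =>
      change (A * ((Y : Matrix ι ι K) + (Z : Matrix ι ι K)) * B) a a = 0
      rw [mul_add, add_mul, Matrix.add_apply, hY, hZ, add_zero]
    | smul t Y _ hY =>
      change (A * (t • (Y : Matrix ι ι K)) * B) a a = 0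
      rw [mul_smul_comm, smul_mul_assoc, Matrix.smul_apply, hY, smul_zero]
  · intro hX
    have hX2 : (X : Matrix ι ι K) = B * (A * X * B) * A := (conj_conj hBA _).symm
    have hspan := mem_span_symUnit ((hmem _).1 X.2) hX
    -- by linearity it is enough to treat the spanning matrices, which are commutators
    suffices h : ∀ Z ∈ Submodule.span K {M | ∃ a b : ι, a ≠ b ∧ M = symUnit K a b},
        ∃ Y : skewAdjointMatricesLieSubalgebra J,
          Y ∈ ⁅(⊤ : LieIdeal K (skewAdjointMatricesLieSubalgebra J)),
            (⊤ : LieIdeal K (skewAdjointMatricesLieSubalgebra J))⁆ ∧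
          (Y : Matrix ι ι K) = B * Z * A by
      obtain ⟨Y, hY, hYZ⟩ := h _ hspan
      rwa [show X = Y from Subtype.ext (hX2.trans hYZ.symm)]
    intro Z hZ
    induction hZ using Submodule.span_induction with
    | mem Z hZ =>
      obtain ⟨a, b, hab, rfl⟩ := hZ
      have h1 : B * single a a 1 * A ∈ skewAdjointMatricesLieSubalgebra J :=
        (hmem _).2 (by rw [conj_conj hAB]; simp)
      have h2 : B * symUnit K a b * A ∈ skewAdjointMatricesLieSubalgebra J :=
        (hmem _).2 (by rw [conj_conj hAB, symUnit_transpose])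
      refine ⟨⁅⟨_, h1⟩, ⟨_, h2⟩⁆,
        LieSubmodule.lie_mem_lie (LieSubmodule.mem_top _) (LieSubmodule.mem_top _), ?_⟩
      · change ⁅B * single a a 1 * A, B * symUnit K a b * A⁆ = _
        rw [← conj_lie hAB, lie_single_symUnit hab]
    | zero => exact ⟨0, zero_mem _, by simp⟩
    | add Y Z _ _ hY hZ =>
      obtain ⟨Y', hY, hY'⟩ := hY
      obtain ⟨Z', hZ, hZ'⟩ := hZ
      refine ⟨Y' + Z', add_mem hY hZ, ?_⟩
      change (Y' : Matrix ι ι K) + (Z' : Matrix ι ι K) = _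
      rw [hY', hZ', mul_add, add_mul]
    | smul t Y _ hY =>
      obtain ⟨Y', hY, hY'⟩ := hY
      refine ⟨t • Y', SMulMemClass.smul_mem t hY, ?_⟩
      change t • (Y' : Matrix ι ι K) = _
      rw [hY', mul_smul_comm, smul_mul_assoc]

/-- The criterion for the derived algebra in terms of `J X` itself, which is congruent to the matrix
of `X` in an orthonormal basis. -/
theorem mem_derived_iff (hAB : A * B = 1) (hBA : B * A = 1) (hJ : J = Aᵀ * A)
    (X : skewAdjointMatricesLieSubalgebra J) :
    X ∈ LieAlgebra.derivedSeries K (skewAdjointMatricesLieSubalgebra J) 1 ↔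
      ∀ a, (J * (X : Matrix ι ι K)) a a = 0 := by
  have hX := (mem_skewAdjoint_iff_symm hAB hBA hJ _).1 X.2
  have hAB' : Bᵀ * Aᵀ = 1 := by rw [← transpose_mul, hAB, transpose_one]
  have hJX : ∀ M, J * M = Aᵀ * (A * M) := fun M => by rw [hJ, Matrix.mul_assoc]
  have h1 : J * (X : Matrix ι ι K) = Aᵀ * (A * X * B) * A := by
    rw [Matrix.mul_assoc _ _ A, Matrix.mul_assoc _ B, hBA, Matrix.mul_one, hJX]
  have h2 : A * (X : Matrix ι ι K) * B = Bᵀ * (J * X) * B := by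
    rw [hJX, ← Matrix.mul_assoc Bᵀ, hAB', Matrix.one_mul]
  rw [mem_derived_iff_diag_conj hAB hBA hJ]
  refine ⟨fun h a => ?_, fun h a => ?_⟩
  · rw [h1]
    exact diag_congr_eq_zero hX h A a
  · rw [h2]
    refine diag_congr_eq_zero ?_ h B a
    rw [h1, transpose_mul, transpose_mul, hX, transpose_transpose, ← Matrix.mul_assoc]

/-- The element of the derived algebra that is `E_{ab} + E_{ba}` in the orthonormal basis. -/
theorem exists_derived_conj_symUnit (hAB : A * B = 1) (hBA : B * A = 1) (hJ : J = Aᵀ * A)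
    {a b : ι} (hab : a ≠ b) :
    ∃ z : LieAlgebra.derivedSeries K (skewAdjointMatricesLieSubalgebra J) 1,
      (z : Matrix ι ι K) = B * symUnit K a b * A := by
  have h : B * symUnit K a b * A ∈ skewAdjointMatricesLieSubalgebra J :=
    (mem_skewAdjoint_iff_symm hAB hBA hJ _).2 (by rw [conj_conj hAB, symUnit_transpose])
  refine ⟨⟨⟨_, h⟩, (mem_derived_iff_diag_conj hAB hBA hJ _).2 fun c => ?_⟩, rfl⟩
  change (A * (B * symUnit K a b * A) * B) c c = 0
  rw [conj_conj hAB, symUnit, Matrix.add_apply, single_apply, single_apply,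
    if_neg (fun h => hab (h.1.trans h.2.symm)), if_neg (fun h => hab (h.2.trans h.1.symm)),
    add_zero]

/-- Only scalar matrices act trivially on the derived algebra, except in size two. -/
theorem exists_eq_smul_one_of_lie_derived_eq_zero (hAB : A * B = 1) (hBA : B * A = 1)
    (hJ : J = Aᵀ * A) (h3 : ∀ a b : ι, a ≠ b → ∃ c, c ≠ a ∧ c ≠ b)
    (X : skewAdjointMatricesLieSubalgebra J)
    (hX : ∀ y : LieAlgebra.derivedSeries K (skewAdjointMatricesLieSubalgebra J) 1, ⁅X, y⁆ = 0) :
    ∃ t : K, (X : Matrix ι ι K) = t • 1 := by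
  obtain ⟨t, ht⟩ := exists_eq_smul_one_of_commute_symUnit h3 (S := A * X * B) (K := K) (by
    intro a b hab
    obtain ⟨z, hz⟩ := exists_derived_conj_symUnit hAB hBA hJ hab
    have h : ⁅(X : Matrix ι ι K), (z : Matrix ι ι K)⁆ = 0 :=
      congrArg (fun y : LieAlgebra.derivedSeries K (skewAdjointMatricesLieSubalgebra J) 1 =>
        (y : Matrix ι ι K)) (hX z)
    have h' := conj_lie hBA (A := A) (X : Matrix ι ι K) z
    rw [h, hz, conj_conj hAB, Matrix.mul_zero, Matrix.zero_mul, Ring.lie_def] at h'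
    exact sub_eq_zero.1 h'.symm)
  refine ⟨t, ?_⟩
  rw [← conj_conj hBA (X : Matrix ι ι K), ht, mul_smul_comm, smul_mul_assoc, Matrix.mul_one, hBA]

/-- Every derivation of the derived algebra is the commutator with a skew-adjoint matrix, except
in sizes two and four. -/
theorem exists_derivation_eq_lie (hAB : A * B = 1) (hBA : B * A = 1) (hJ : J = Aᵀ * A)
    (h3 : ∀ a b : ι, a ≠ b → ∃ c, c ≠ a ∧ c ≠ b)
    (h5 : ∀ a b c d : ι, a ≠ b → a ≠ c → a ≠ d → b ≠ c → b ≠ d → c ≠ d →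
      ∃ e, e ≠ a ∧ e ≠ b ∧ e ≠ c ∧ e ≠ d)
    (D : LieDerivation K (LieAlgebra.derivedSeries K (skewAdjointMatricesLieSubalgebra J) 1)
      (LieAlgebra.derivedSeries K (skewAdjointMatricesLieSubalgebra J) 1)) :
    ∃ X : skewAdjointMatricesLieSubalgebra J, ∀ y, D y = ⁅X, y⁆ := by
  have hmem := mem_skewAdjoint_iff_symm hAB hBA hJ
  have hex : ∀ a b : ι, ∃ z : LieAlgebra.derivedSeries K (skewAdjointMatricesLieSubalgebra J) 1,
      a ≠ b → (z : Matrix ι ι K) = B * symUnit K a b * A := by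
    intro a b
    by_cases hab : a = b
    · exact ⟨0, fun h => absurd hab h⟩
    · obtain ⟨z, hz⟩ := exists_derived_conj_symUnit hAB hBA hJ hab
      exact ⟨z, fun _ => hz⟩
  choose z hz using hex
  have coe_inj : ∀ x y : LieAlgebra.derivedSeries K (skewAdjointMatricesLieSubalgebra J) 1,
      (x : Matrix ι ι K) = y → x = y := fun x y h => Subtype.ext (Subtype.ext h)
  have coe_lie : ∀ x y : LieAlgebra.derivedSeries K (skewAdjointMatricesLieSubalgebra J) 1,
      ((⁅x, y⁆ : LieAlgebra.derivedSeries K (skewAdjointMatricesLieSubalgebra J) 1) :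
        Matrix ι ι K) = ⁅(x : Matrix ι ι K), (y : Matrix ι ι K)⁆ := fun _ _ => rfl
  obtain ⟨S, hS, hFS⟩ := exists_symm_of_leibniz (K := K) h3 h5
    (fun a b => if a = b then 0 else A * (D (z a b) : Matrix ι ι K) * B)
    (by
      intro a b
      by_cases hab : a = b
      · simp [hab]
      · rw [if_neg hab, if_neg (Ne.symm hab), coe_inj (z a b) (z b a) (by
          rw [hz a b hab, hz b a (Ne.symm hab), symUnit_comm])])
    (by
      intro a b
      split_ifs
      · simp
      · exact (hmem _).1 (D (z a b)).1.2)
    (by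
      intro a b
      split_ifs
      · simp
      · exact (mem_derived_iff_diag_conj hAB hBA hJ _).1 (D (z a b)).2)
    (by
      intro a b c hab hbc hac
      rw [if_neg hab, if_neg hac, if_neg hbc.symm]
      have h : z a b = ⁅z a c, z c b⁆ := coe_inj _ _ (by
        rw [coe_lie, hz _ _ hab, hz _ _ hac, hz _ _ hbc.symm, ← conj_lie hAB,
          symUnit_eq_lie hab hbc hac])
      rw [h, LieDerivation.apply_lie_eq_add]
      change A * (⁅(z a c : Matrix ι ι K), (D (z c b) : Matrix ι ι K)⁆ +
        ⁅(D (z a c) : Matrix ι ι K), (z c b : Matrix ι ι K)⁆) * B = _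
      rw [mul_add, add_mul, conj_lie hBA, conj_lie hBA, hz _ _ hac, hz _ _ hbc.symm,
        conj_conj hAB, conj_conj hAB, add_comm])
  let X : skewAdjointMatricesLieSubalgebra J :=
    ⟨B * S * A, (hmem _).2 (by rw [conj_conj hAB, hS])⟩
  refine ⟨X, fun y => ?_⟩
  -- both sides are linear in `y` and agree on a spanning set
  have hspan := mem_span_symUnit ((hmem _).1 y.1.2) ((mem_derived_iff_diag_conj hAB hBA hJ _).1 y.2)
  suffices h : ∀ Z ∈ Submodule.span K {M | ∃ a b : ι, a ≠ b ∧ M = symUnit K a b},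
      ∃ y : LieAlgebra.derivedSeries K (skewAdjointMatricesLieSubalgebra J) 1,
        (y : Matrix ι ι K) = B * Z * A ∧ D y = ⁅X, y⁆ by
    obtain ⟨y', hy', hD⟩ := h _ hspan
    rwa [show y = y' from coe_inj _ _ (by rw [hy', conj_conj hBA])]
  intro Z hZ
  induction hZ using Submodule.span_induction with
  | mem Z hZ =>
    obtain ⟨a, b, hab, rfl⟩ := hZ
    refine ⟨z a b, hz a b hab, coe_inj _ _ ?_⟩
    have h := hFS a b hab
    rw [if_neg hab] at h
    change _ = ⁅B * S * A, (z a b : Matrix ι ι K)⁆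
    rw [hz a b hab, ← conj_lie hAB, ← h, conj_conj hBA]
  | zero => exact ⟨0, by simp, by simp⟩
  | add Y Z _ _ hY hZ =>
    obtain ⟨Y', hY, hY'⟩ := hY
    obtain ⟨Z', hZ, hZ'⟩ := hZ
    refine ⟨Y' + Z', ?_, by rw [map_add, hY', hZ', lie_add]⟩
    change (Y' : Matrix ι ι K) + (Z' : Matrix ι ι K) = _
    rw [hY, hZ, mul_add, add_mul]
  | smul t Y _ hY =>
    obtain ⟨Y', hY, hY'⟩ := hY
    refine ⟨t • Y', ?_, by rw [map_smul, hY', lie_smul]⟩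
    change t • (Y' : Matrix ι ι K) = _
    rw [hY, mul_smul_comm, smul_mul_assoc]

end Orthonormal

/-! ### An orthonormal basis for the form `Π` -/

section PiForm

variable (K : Type*) [Field K] (n : ℕ)

/-- The permutation of the labels that exchanges the outer two blocks. -/
def piSwap : PiIndex n → PiIndex n
  | Sum.inl i => Sum.inr (Sum.inr i)
  | Sum.inr (Sum.inl u) => Sum.inr (Sum.inl u)
  | Sum.inr (Sum.inr i) => Sum.inl i

theorem piSwap_piSwap (a : PiIndex n) : piSwap n (piSwap n a) = a := by
  rcases a with i | _ | i <;> rfl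

theorem piMatrix_apply (a b : PiIndex n) : piMatrix K n a b = if a = piSwap n b then 1 else 0 := by
  rcases a with i | _ | i <;> rcases b with k | _ | k <;> simp [piMatrix, piSwap]

theorem piMatrix_mul_apply (M : Matrix (PiIndex n) (PiIndex n) K) (a b : PiIndex n) :
    (piMatrix K n * M) a b = M (piSwap n a) b := by
  rw [Matrix.mul_apply, Finset.sum_eq_single (piSwap n a)]
  · rw [piMatrix_apply, piSwap_piSwap, if_pos rfl, one_mul]
  · intro c _ hc
    rw [piMatrix_apply, if_neg (fun h => hc (by rw [h, piSwap_piSwap])), zero_mul]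
  · simp

theorem piMatrix_mul_self : piMatrix K n * piMatrix K n = 1 := by
  ext a b
  rw [piMatrix_mul_apply, piMatrix_apply, Matrix.one_apply]
  have : piSwap n a = piSwap n b ↔ a = b :=
    ⟨fun h => by rw [← piSwap_piSwap n a, h, piSwap_piSwap], fun h => by rw [h]⟩
  simp [this]

/-- The matrix whose columns are the coordinates of the basis `p_i, r, q_i` (with Gram matrix `Π`)
in an orthonormal basis `e_i, e, f_i`: with `w_i = e + ∑_{j < i} (e_j + f_j)` one takes
`p_i = w_i + e_i`, `q_i = w_i + f_i` and `r = w_n`. -/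
def piFrame : Matrix (PiIndex n) (PiIndex n) K :=
  Matrix.of fun a b =>
    match a, b with
    | Sum.inl j, Sum.inl i => (if j < i then 1 else 0) + (if j = i then 1 else 0)
    | Sum.inl _, Sum.inr (Sum.inl _) => 1
    | Sum.inl j, Sum.inr (Sum.inr i) => if j < i then 1 else 0
    | Sum.inr (Sum.inl _), _ => 1
    | Sum.inr (Sum.inr j), Sum.inl i => if j < i then 1 else 0
    | Sum.inr (Sum.inr _), Sum.inr (Sum.inl _) => 1
    | Sum.inr (Sum.inr j), Sum.inr (Sum.inr i) =>
      (if j < i then 1 else 0) + (if j = i then 1 else 0)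

variable [CharP K 2]

theorem piMatrix_eq_transpose_mul_piFrame : piMatrix K n = (piFrame K n)ᵀ * piFrame K n := by
  -- the indicators of `j < i` and `j = i` are made opaque; what is used of them is `htri`, `hsum`
  obtain ⟨L, hL⟩ : ∃ L : Fin n → Fin n → K, ∀ j i, (if j < i then (1 : K) else 0) = L j i :=
    ⟨_, fun _ _ => rfl⟩
  obtain ⟨δ, hδ⟩ : ∃ δ : Fin n → Fin n → K, ∀ j i, (if j = i then (1 : K) else 0) = δ j i :=
    ⟨_, fun _ _ => rfl⟩
  have h2 : ∀ t : K, t + t = 0 := CharTwo.add_self_eq_zero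
  have htri : ∀ i k, L i k + L k i + δ i k = 1 := by
    intro i k
    rw [← hL, ← hL, ← hδ]
    rcases lt_trichotomy i k with h | h | h
    · simp [h, h.not_gt, h.ne]
    · simp [h]
    · simp [h, h.not_gt, h.ne']
  have hsum : ∀ i (f : Fin n → K), ∑ j, δ j i * f j = f i := fun i f => by simp [← hδ]
  have hLl : ∀ i (f : Fin n → K),
      ∑ j, (L j i + δ j i) * f j = ∑ j, L j i * f j + f i := fun i f => by
    rw [← hsum i f, ← Finset.sum_add_distrib]
    exact Finset.sum_congr rfl fun j _ => by ring
  have hLr : ∀ i k, ∑ j, L j i * (L j k + δ j k) = ∑ j, L j i * L j k + L k i := fun i k => by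
    rw [← hsum k fun j => L j i, ← Finset.sum_add_distrib]
    exact Finset.sum_congr rfl fun j _ => by ring
  have hLr' : ∀ k, ∑ j, 1 * (L j k + δ j k) = ∑ j, 1 * L j k + 1 := fun k => by
    have h := hsum k fun _ => 1
    simp only [mul_one] at h
    simp only [one_mul, Finset.sum_add_distrib, h]
  ext a b
  rw [Matrix.mul_apply]
  simp only [transpose_apply, Fintype.sum_sum_type, Finset.univ_unique, Finset.sum_singleton]
  rcases a with i | _ | i <;> rcases b with k | _ | k <;>
    simp only [piMatrix, piFrame, Matrix.of_apply, hL, hδ, hLl, hLr, hLr']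
  · linear_combination (-1 : K) * htri i k - h2 (∑ j, L j i * L j k) - h2 1
  · linear_combination -h2 (∑ j, L j i * 1) - h2 1
  · linear_combination -htri i k - h2 (∑ j, L j i * L j k) + h2 (δ i k) - h2 1
  · linear_combination -h2 (∑ j, 1 * L j k) - h2 1
  · linear_combination -h2 (∑ j : Fin n, (1 : K) * 1)
  · linear_combination -h2 (∑ j, 1 * L j k) - h2 1
  · linear_combination -htri i k - h2 (∑ j, L j i * L j k) + h2 (δ i k) - h2 1
  · linear_combination -h2 (∑ j, L j i * 1) - h2 1
  · linear_combination (-1 : K) * htri i k - h2 (∑ j, L j i * L j k) - h2 1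

/-- The inverse of `piFrame`. -/
def piFrameInv : Matrix (PiIndex n) (PiIndex n) K := piMatrix K n * (piFrame K n)ᵀ

theorem piFrameInv_mul_piFrame : piFrameInv K n * piFrame K n = 1 := by
  rw [piFrameInv, Matrix.mul_assoc, ← piMatrix_eq_transpose_mul_piFrame, piMatrix_mul_self]

theorem piFrame_mul_piFrameInv : piFrame K n * piFrameInv K n = 1 :=
  mul_eq_one_comm.1 (piFrameInv_mul_piFrame K n)

theorem piIndex_exists_ne_ne (a b : PiIndex n) (hab : a ≠ b) : ∃ c, c ≠ a ∧ c ≠ b := by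
  have hcard : Fintype.card (PiIndex n) = 2 * n + 1 := by simp; omega
  have h2 : ({a, b} : Finset (PiIndex n)).card = 2 := Finset.card_pair hab
  have hle := Finset.card_le_univ ({a, b} : Finset (PiIndex n))
  obtain ⟨c, -, hc⟩ := Finset.exists_mem_notMem_of_card_lt_card
    (s := ({a, b} : Finset (PiIndex n))) (t := Finset.univ) (by rw [Finset.card_univ]; omega)
  exact ⟨c, by simpa using hc⟩

/-- A set of odd order with four elements has a fifth one. -/
theorem piIndex_exists_fifth (a b c d : PiIndex n) (hab : a ≠ b) (hac : a ≠ c) (had : a ≠ d)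
    (hbc : b ≠ c) (hbd : b ≠ d) (hcd : c ≠ d) : ∃ e, e ≠ a ∧ e ≠ b ∧ e ≠ c ∧ e ≠ d := by
  have hcard : Fintype.card (PiIndex n) = 2 * n + 1 := by simp; omega
  have h4 : ({a, b, c, d} : Finset (PiIndex n)).card = 4 := by
    rw [Finset.card_insert_of_notMem (by simp [hab, hac, had]),
      Finset.card_insert_of_notMem (by simp [hbc, hbd]), Finset.card_pair hcd]
  have hle := Finset.card_le_univ ({a, b, c, d} : Finset (PiIndex n))
  obtain ⟨e, -, he⟩ := Finset.exists_mem_notMem_of_card_lt_card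
    (s := ({a, b, c, d} : Finset (PiIndex n))) (t := Finset.univ)
    (by rw [Finset.card_univ]; omega)
  exact ⟨e, by simpa using he⟩

variable {K n}

theorem mem_orthPiDerived_iff (X : orthPi K n) :
    X ∈ orthPiDerived K n ↔ ∀ a, (X : Matrix (PiIndex n) (PiIndex n) K) (piSwap n a) a = 0 := by
  refine (mem_derived_iff (piFrame_mul_piFrameInv K n) (piFrameInv_mul_piFrame K n)
    (piMatrix_eq_transpose_mul_piFrame K n) X).trans ?_
  simp only [piMatrix_mul_apply]

theorem exists_eq_smul_one_of_lie_orthPiDerived (X : orthPi K n)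
    (hX : ∀ y : orthPiDerived K n, ⁅X, y⁆ = 0) :
    ∃ t : K, (X : Matrix (PiIndex n) (PiIndex n) K) = t • 1 :=
  exists_eq_smul_one_of_lie_derived_eq_zero (piFrame_mul_piFrameInv K n)
    (piFrameInv_mul_piFrame K n) (piMatrix_eq_transpose_mul_piFrame K n)
    (piIndex_exists_ne_ne n) X hX

theorem exists_orthPi_derivation_eq_lie
    (D : LieDerivation K (orthPiDerived K n) (orthPiDerived K n)) :
    ∃ X : orthPi K n, ∀ y, D y = ⁅X, y⁆ :=
  exists_derivation_eq_lie (piFrame_mul_piFrameInv K n) (piFrameInv_mul_piFrame K n)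
    (piMatrix_eq_transpose_mul_piFrame K n) (piIndex_exists_ne_ne n) (piIndex_exists_fifth n) D

/-- Entrywise form of the symmetry of `Π X`. -/
theorem mem_orthPi_iff (X : Matrix (PiIndex n) (PiIndex n) K) :
    X ∈ orthPi K n ↔ ∀ a b, X (piSwap n b) a = X (piSwap n a) b := by
  have hs : (piMatrix K n)ᵀ = piMatrix K n := by
    rw [piMatrix_eq_transpose_mul_piFrame, transpose_mul, transpose_transpose]
  have h : Xᵀ * piMatrix K n = (piMatrix K n * X)ᵀ := by rw [transpose_mul, hs]
  rw [mem_skewAdjoint_iff_of_charTwo, h, ← Matrix.ext_iff]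
  simp only [transpose_apply, piMatrix_mul_apply]

end PiForm

/-! ### Derivations of an ideal and its first cohomology -/

section IdealDerivation

variable {R L : Type*} [CommRing R] [LieRing L] [LieAlgebra R L]

/-- A Lie algebra acts on each of its ideals by derivations. -/
def LieIdeal.actionDerivation (I : LieIdeal R L) : L →ₗ⁅R⁆ LieDerivation R I I where
  toFun X :=
    { toFun := fun y => ⁅X, y⁆
      map_add' := fun y z => lie_add X y z
      map_smul' := fun t y => lie_smul t X y
      leibniz' := fun a b => Subtype.ext <| by
        change ⁅X, ⁅(a : L), (b : L)⁆⁆ = ⁅(a : L), ⁅X, (b : L)⁆⁆ - ⁅(b : L), ⁅X, (a : L)⁆⁆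
        rw [leibniz_lie X, ← lie_skew ⁅X, (a : L)⁆ (b : L), neg_add_eq_sub] }
  map_add' X Y := LieDerivation.ext fun y => add_lie X Y y
  map_smul' t X := LieDerivation.ext fun y => smul_lie t X y
  map_lie' {X Y} := LieDerivation.ext fun y => by
    rw [LieDerivation.commutator_apply]
    exact lie_lie X Y y

/-- Derivations of a Lie algebra are the 1-cocycles with values in the adjoint module. -/
def LieDerivation.toCocycle : LieDerivation R L L →ₗ[R] lieZ1 R L L where
  toFun D := ⟨D, LinearMap.mem_ker.2 <| by
    ext x y
    change ⁅x, D y⁆ - ⁅y, D x⁆ - D ⁅x, y⁆ = 0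
    rw [LieDerivation.apply_lie_eq_sub, sub_self]⟩
  map_add' _ _ := rfl
  map_smul' _ _ := rfl

theorem LieDerivation.toCocycle_surjective :
    Function.Surjective (LieDerivation.toCocycle (R := R) (L := L)) := by
  rintro ⟨f, hf⟩
  have h : ∀ x y, ⁅x, f y⁆ - ⁅y, f x⁆ - f ⁅x, y⁆ = 0 := fun x y => by
    rw [← d₁₂_apply_apply, LinearMap.mem_ker.1 hf]
    rfl
  exact ⟨⟨f, fun x y => (sub_eq_zero.1 (h x y)).symm⟩, rfl⟩

/-- The class in `H¹(I; I)` of the derivation of an ideal `I` given by an element of the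
ambient Lie algebra. -/
def LieIdeal.actionClass (I : LieIdeal R L) : L →ₗ[R] lieH1 R I I :=
  lieH1Mk R I I ∘ₗ LieDerivation.toCocycle ∘ₗ (I.actionDerivation : L →ₗ[R] LieDerivation R I I)

theorem LieIdeal.actionClass_apply (I : LieIdeal R L) (X : L) :
    I.actionClass X = lieH1Mk R I I (LieDerivation.toCocycle (I.actionDerivation X)) := rfl

/-- The class vanishes when the element acts on the ideal as an element of the ideal does. -/
theorem LieIdeal.actionClass_eq_zero_iff (I : LieIdeal R L) (X : L) :
    I.actionClass X = 0 ↔ ∃ m : I, ∀ y : I, ⁅X - m, y⁆ = 0 := by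
  have hskew : ∀ m y : I, ⁅(m : L), y⁆ = -⁅y, m⁆ := fun m y => (lie_skew m y).symm
  rw [LieIdeal.actionClass_apply, lieH1Mk, Submodule.mkQ_apply, Submodule.Quotient.mk_eq_zero,
    Submodule.submoduleOf,
    Submodule.mem_comap, lieB1, LinearMap.mem_range]
  constructor
  · rintro ⟨m, hm⟩
    -- the coboundary of `m` is `y ↦ ⁅y, m⁆`, the inner derivation given by `-m`
    refine ⟨-m, fun y => ?_⟩
    have h : ⁅y, m⁆ = ⁅X, y⁆ := LinearMap.congr_fun hm y
    rw [sub_lie, hskew, lie_neg, neg_neg, h, sub_self]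
  · rintro ⟨m, hm⟩
    refine ⟨-m, ?_⟩
    ext1 y
    change ⁅y, -m⁆ = ⁅X, y⁆
    rw [lie_neg, ← hskew, ← sub_eq_zero, ← sub_lie, ← neg_sub, neg_lie, hm, neg_zero]

/-- If every derivation of an ideal `I` comes from the ambient Lie algebra `L` and only the center
of `L` acts trivially on `I`, then `L` modulo its center is the algebra of derivations of `I`. -/
noncomputable def LieIdeal.quotientCenterEquivDerivation (I : LieIdeal R L)
    (hcenter : ∀ X : L, (∀ y : I, ⁅X, y⁆ = 0) ↔ X ∈ LieAlgebra.center R L)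
    (hder : ∀ D : LieDerivation R I I, ∃ X : L, ∀ y, D y = ⁅X, y⁆) :
    (L ⧸ LieAlgebra.center R L) ≃ₗ⁅R⁆ LieDerivation R I I :=
  let ad : L →ₗ[R] LieDerivation R I I := I.actionDerivation
  have hker : (LieAlgebra.center R L).toSubmodule = LinearMap.ker ad := by
    ext X
    rw [LieSubmodule.mem_toSubmodule, ← hcenter, LinearMap.mem_ker]
    exact ⟨fun h => LieDerivation.ext h, fun h y => LieDerivation.congr_fun h y⟩
  let f : (L ⧸ LieAlgebra.center R L) →ₗ[R] LieDerivation R I I :=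
    (LieAlgebra.center R L).toSubmodule.liftQ ad hker.le
  have hinj : Function.Injective f :=
    LinearMap.ker_eq_bot.1 (Submodule.ker_liftQ_eq_bot _ _ _ hker.ge)
  have hsurj : Function.Surjective f := fun D => by
    obtain ⟨X, hX⟩ := hder D
    exact ⟨LieSubmodule.Quotient.mk' _ X, LieDerivation.ext fun y => (hX y).symm⟩
  { LinearEquiv.ofBijective f ⟨hinj, hsurj⟩ with
    map_lie' := by
      intro x y
      obtain ⟨X, rfl⟩ := LieSubmodule.Quotient.surjective_mk' _ x
      obtain ⟨Y, rfl⟩ := LieSubmodule.Quotient.surjective_mk' _ y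
      exact LieHom.map_lie I.actionDerivation X Y }

theorem LieIdeal.quotientCenterEquivDerivation_mk (I : LieIdeal R L)
    (hcenter : ∀ X : L, (∀ y : I, ⁅X, y⁆ = 0) ↔ X ∈ LieAlgebra.center R L)
    (hder : ∀ D : LieDerivation R I I, ∃ X : L, ∀ y, D y = ⁅X, y⁆) (X : L) (y : I) :
    I.quotientCenterEquivDerivation hcenter hder
      (LieSubmodule.Quotient.mk' (LieAlgebra.center R L) X) y = ⁅X, y⁆ := rfl

theorem LieIdeal.actionClass_surjective (I : LieIdeal R L)
    (hder : ∀ D : LieDerivation R I I, ∃ X : L, ∀ y, D y = ⁅X, y⁆) :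
    Function.Surjective I.actionClass := by
  intro x
  obtain ⟨c, rfl⟩ := Submodule.mkQ_surjective _ x
  obtain ⟨D, rfl⟩ := LieDerivation.toCocycle_surjective c
  obtain ⟨X, hX⟩ := hder D
  refine ⟨X, ?_⟩
  rw [LieIdeal.actionClass_apply, show D = I.actionDerivation X from LieDerivation.ext hX]
  rfl

end IdealDerivation

section QuotientBasis

variable {κ F V W : Type*} [Fintype κ] [DecidableEq κ] [CommRing F] [AddCommGroup V] [Module F V]
  [AddCommGroup W] [Module F W]

/-- The basis of a quotient `f : V → W` formed by the images of vectors `s i` that are dual to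
coordinates `δ` on `V` with the same kernel as `f`. -/
noncomputable def basisOfDualCoordinates (f : V →ₗ[F] W) (hf : Function.Surjective f)
    (δ : V →ₗ[F] κ → F) (s : κ → V) (hs : ∀ i, δ (s i) = Pi.single i 1)
    (hker : ∀ v, f v = 0 ↔ δ v = 0) : Module.Basis κ F W :=
  have hsum : ∀ c : κ → F, δ (∑ j, c j • s j) = c := fun c => by
    ext i
    simp [map_sum, hs, Pi.single_apply]
  Module.Basis.mk (v := fun i => f (s i))
    (by
      rw [Fintype.linearIndependent_iff]
      intro c hc i
      simp only [← map_smul, ← map_sum] at hc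
      rw [hker, hsum] at hc
      exact congrFun hc i)
    (by
      intro x _
      obtain ⟨v, rfl⟩ := hf x
      have h : f (v - ∑ j, δ v j • s j) = 0 := by rw [hker, map_sub, hsum, sub_self]
      rw [map_sub, sub_eq_zero] at h
      rw [h, map_sum]
      refine Submodule.sum_mem _ fun i _ => ?_
      rw [map_smul]
      exact Submodule.smul_mem _ _ (Submodule.subset_span ⟨i, rfl⟩))

theorem basisOfDualCoordinates_apply (f : V →ₗ[F] W) (hf : Function.Surjective f)
    (δ : V →ₗ[F] κ → F) (s : κ → V) (hs : ∀ i, δ (s i) = Pi.single i 1)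
    (hker : ∀ v, f v = 0 ↔ δ v = 0) (i : κ) :
    basisOfDualCoordinates f hf δ s hs hker i = f (s i) := by
  simp [basisOfDualCoordinates]

end QuotientBasis

/-! ### The outer derivations and their weights -/

section Outer

variable {K : Type*} [Field K] {n : ℕ}

theorem piHomogeneous_mul {X Y : Matrix (PiIndex n) (PiIndex n) K} {d e : ℤ}
    (hX : piHomogeneous X d) (hY : piHomogeneous Y e) : piHomogeneous (X * Y) (d + e) := by
  intro a b hab
  rw [Matrix.mul_apply] at hab
  obtain ⟨c, -, hc⟩ := Finset.exists_ne_zero_of_sum_ne_zero hab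
  rw [← hX a c (left_ne_zero_of_mul hc), ← hY c b (right_ne_zero_of_mul hc)]
  ring

theorem cochainHasWeight_toCocycle {X : orthPi K n} {w : ℤ}
    (hX : piHomogeneous (X : Matrix (PiIndex n) (PiIndex n) K) w) :
    CochainHasWeight (LieDerivation.toCocycle ((orthPiDerived K n).actionDerivation X) :
      oneCochain K (orthPiDerived K n) (orthPiDerived K n)) w := by
  intro y d hy a b hab
  change ((X : Matrix (PiIndex n) (PiIndex n) K) * (y : Matrix (PiIndex n) (PiIndex n) K) -
    (y : Matrix (PiIndex n) (PiIndex n) K) * (X : Matrix (PiIndex n) (PiIndex n) K)) a b ≠ 0 at hab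
  rw [Matrix.sub_apply] at hab
  by_cases h : ((X : Matrix (PiIndex n) (PiIndex n) K) *
      (y : Matrix (PiIndex n) (PiIndex n) K)) a b = 0
  · rw [h, zero_sub, neg_ne_zero] at hab
    exact piHomogeneous_mul hy hX a b hab
  · rw [add_comm]
    exact piHomogeneous_mul hX hy a b h

variable [CharP K 2]

theorem mem_center_orthPi_iff (X : orthPi K n) :
    X ∈ LieAlgebra.center K (orthPi K n) ↔
      ∃ t : K, (X : Matrix (PiIndex n) (PiIndex n) K) = t • 1 := by
  rw [LieModule.mem_maxTrivSubmodule]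
  constructor
  · intro h
    refine exists_eq_smul_one_of_lie_orthPiDerived X fun y => Subtype.ext ?_
    change ⁅X, (y : orthPi K n)⁆ = 0
    rw [← lie_skew, h, neg_zero]
  · rintro ⟨t, ht⟩ Y
    refine Subtype.ext ?_
    change ⁅(Y : Matrix (PiIndex n) (PiIndex n) K), (X : Matrix (PiIndex n) (PiIndex n) K)⁆ = 0
    rw [ht, Ring.lie_def, mul_smul_comm, smul_mul_assoc, one_mul, mul_one, sub_self]

/-- The centralizer of `𝔤` in `𝔬_Π(2n+1)` is the center. -/
theorem lie_orthPiDerived_eq_zero_iff (X : orthPi K n) :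
    (∀ y : orthPiDerived K n, ⁅X, y⁆ = 0) ↔ X ∈ LieAlgebra.center K (orthPi K n) := by
  refine ⟨fun h => (mem_center_orthPi_iff X).2 (exists_eq_smul_one_of_lie_orthPiDerived X h),
    fun h y => Subtype.ext ?_⟩
  change ⁅X, (y : orthPi K n)⁆ = 0
  rw [← lie_skew, (LieModule.mem_maxTrivSubmodule K (orthPi K n) (orthPi K n) X).1 h, neg_zero]

/-- The labels of the outer two blocks. -/
def outerLabel : Fin n ⊕ Fin n → PiIndex n
  | Sum.inl i => Sum.inl i
  | Sum.inr i => Sum.inr (Sum.inr i)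

theorem outerLabel_injective : Function.Injective (outerLabel (n := n)) := by
  rintro (i | i) (j | j) <;> simp [outerLabel]

theorem piSwap_outerLabel_ne (i : Fin n ⊕ Fin n) : piSwap n (outerLabel i) ≠ outerLabel i := by
  rcases i with i | i <;> simp [outerLabel, piSwap]

theorem piWeight_piSwap (a : PiIndex n) : piWeight n (piSwap n a) = -piWeight n a := by
  rcases a with i | _ | i <;> simp [piWeight, piSwap]

/-- An element of `𝔬_Π(2n+1)` acts on the derived algebra by an inner derivation if and only if the
diagonal of its product with `Π` vanishes away from the middle entry: the scalar matrices account
for the middle entry. -/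
theorem actionClass_orthPiDerived_eq_zero_iff (X : orthPi K n) :
    (orthPiDerived K n).actionClass X = 0 ↔ ∀ i : Fin n ⊕ Fin n,
      (X : Matrix (PiIndex n) (PiIndex n) K) (piSwap n (outerLabel i)) (outerLabel i) = 0 := by
  rw [LieIdeal.actionClass_eq_zero_iff]
  constructor
  · rintro ⟨m, hm⟩ i
    obtain ⟨t, ht⟩ := exists_eq_smul_one_of_lie_orthPiDerived _ hm
    have hX : (X : Matrix (PiIndex n) (PiIndex n) K) = t • 1 + (m : orthPi K n) := by
      rw [← ht]
      exact (sub_add_cancel _ _).symm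
    rw [hX, Matrix.add_apply, (mem_orthPiDerived_iff _).1 m.2, Matrix.smul_apply,
      Matrix.one_apply_ne (piSwap_outerLabel_ne i), smul_zero, add_zero]
  · intro h
    -- subtracting the scalar matrix with the middle diagonal entry of `X` gives an element of `𝔤`
    set r : PiIndex n := Sum.inr (Sum.inl ()) with hr
    set t : K := (X : Matrix (PiIndex n) (PiIndex n) K) r r with ht
    have h1 : (1 : Matrix (PiIndex n) (PiIndex n) K) ∈ orthPi K n := by
      rw [mem_orthPi_iff]
      intro a b
      rw [Matrix.one_apply, Matrix.one_apply]
      congr 1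
      rw [eq_iff_iff]
      constructor
      · rintro rfl; rw [piSwap_piSwap]
      · rintro rfl; rw [piSwap_piSwap]
    let s : orthPi K n := t • ⟨1, h1⟩
    have hs : (s : Matrix (PiIndex n) (PiIndex n) K) = t • 1 := rfl
    have hmem : X - s ∈ orthPiDerived K n := by
      rw [mem_orthPiDerived_iff]
      intro a
      change (X : Matrix (PiIndex n) (PiIndex n) K) (piSwap n a) a - (t • 1 :
        Matrix (PiIndex n) (PiIndex n) K) (piSwap n a) a = 0
      rcases a with i | u | i
      · have := h (Sum.inl i)
        simp only [outerLabel] at this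
        rw [this]
        simp [piSwap]
      · simp [piSwap, ht, hr]
      · have := h (Sum.inr i)
        simp only [outerLabel] at this
        rw [this]
        simp [piSwap]
    refine ⟨⟨X - s, hmem⟩,
      (lie_orthPiDerived_eq_zero_iff _).2 ((mem_center_orthPi_iff _).2 ⟨t, ?_⟩)⟩
    rw [← hs]
    exact congrArg _ (sub_sub_cancel X s)

variable (K) in
/-- The matrix unit `E^{a',a}`, where `a'` is the label opposite to `a`: it is `Π` times a diagonal
matrix unit. -/
def piSingle (a : PiIndex n) : orthPi K n :=
  ⟨single (piSwap n a) a 1, by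
    rw [mem_orthPi_iff]
    intro c b
    have hinj : ∀ x y, piSwap n x = piSwap n y ↔ x = y := fun x y =>
      ⟨fun h => by rw [← piSwap_piSwap n x, h, piSwap_piSwap], fun h => by rw [h]⟩
    simp only [single_apply, hinj]
    congr 1
    rw [eq_iff_iff]
    exact and_comm⟩

theorem piHomogeneous_piSingle (a : PiIndex n) :
    piHomogeneous (piSingle K a : Matrix (PiIndex n) (PiIndex n) K) (-2 * piWeight n a) := by
  intro x y hxy
  obtain ⟨rfl, rfl⟩ : piSwap n a = x ∧ a = y := by
    by_contra h
    exact hxy (by simp [piSingle, h])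
  rw [piWeight_piSwap]
  ring

variable (K n) in
/-- The diagonal of `Π X` away from the middle entry. -/
def outerDiag : orthPi K n →ₗ[K] Fin n ⊕ Fin n → K where
  toFun X i := (X : Matrix (PiIndex n) (PiIndex n) K) (piSwap n (outerLabel i)) (outerLabel i)
  map_add' _ _ := rfl
  map_smul' _ _ := rfl

theorem outerDiag_piSingle (i : Fin n ⊕ Fin n) :
    outerDiag K n (piSingle K (outerLabel i)) = Pi.single i 1 := by
  ext j
  change (single _ _ 1 : Matrix (PiIndex n) (PiIndex n) K) _ _ = _
  by_cases h : j = i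
  · subst h; simp
  · rw [single_apply, if_neg fun h' => h (outerLabel_injective h'.2).symm, Pi.single_eq_of_ne h]

variable (K n) in
/-- The classes of the commutators with the matrix units `E^{a',a}`, where `a` runs over the labels
of the outer two blocks, form a basis of the first cohomology. -/
noncomputable def orthPiH1Basis : Module.Basis (Fin n ⊕ Fin n) K
    (lieH1 K (orthPiDerived K n) (orthPiDerived K n)) :=
  basisOfDualCoordinates (orthPiDerived K n).actionClass
    ((orthPiDerived K n).actionClass_surjective exists_orthPi_derivation_eq_lie)
    (outerDiag K n) (fun i => piSingle K (outerLabel i)) outerDiag_piSingle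
    fun X => (actionClass_orthPiDerived_eq_zero_iff X).trans
      ⟨fun h => funext h, fun h i => congrFun h i⟩

theorem orthPiH1Basis_apply (i : Fin n ⊕ Fin n) :
    orthPiH1Basis K n i = (orthPiDerived K n).actionClass (piSingle K (outerLabel i)) :=
  basisOfDualCoordinates_apply _ _ _ _ _ _ i

variable (n) in
/-- The weights `-2 d_a` of the basis of the first cohomology are the nonzero even integers of
absolute value at most `2n`, each taken once. -/
noncomputable def outerWeightEquiv :
    Fin n ⊕ Fin n ≃ {w : ℤ // Even w ∧ w ≠ 0 ∧ |w| ≤ 2 * (n : ℤ)} :=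
  Equiv.ofBijective
    (fun i => ⟨-2 * piWeight n (outerLabel i), ⟨-piWeight n (outerLabel i), by ring⟩, by
      rw [abs_le]
      rcases i with i | i <;> simp only [outerLabel, piWeight] <;> have := i.isLt <;> omega⟩)
    (by
      constructor
      · rintro (i | i) (j | j) h <;> simp only [outerLabel, piWeight, Subtype.mk.injEq] at h <;>
          have := i.isLt <;> have := j.isLt
        · exact congrArg _ (Fin.ext (by omega))
        · omega
        · omega
        · exact congrArg _ (Fin.ext (by omega))
      · rintro ⟨w, ⟨k, rfl⟩, h0, hw⟩
        rw [abs_le] at hw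
        rcases lt_or_gt_of_ne (show k ≠ 0 by omega) with hk | hk
        · refine ⟨Sum.inl ⟨(n + k).toNat, by omega⟩, Subtype.ext ?_⟩
          simp only [outerLabel, piWeight]
          omega
        · refine ⟨Sum.inr ⟨(n - k).toNat, by omega⟩, Subtype.ext ?_⟩
          simp only [outerLabel, piWeight]
          omega)

theorem coe_outerWeightEquiv (i : Fin n ⊕ Fin n) :
    (outerWeightEquiv n i : ℤ) = -2 * piWeight n (outerLabel i) := rfl

end Outer

theorem mainTheorem2 (K : Type*) [Field K] [IsAlgClosed K] [CharP K 2] (n : ℕ) :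
    -- a basis of `H¹(𝔤; 𝔤)` by classes of cocycles of weights `±2, ±4, …, ±2n`, one of each
    (Module.finrank K (lieH1 K (orthPiDerived K n) (orthPiDerived K n)) = 2 * n ∧
      ∃ (c : {w : ℤ // Even w ∧ w ≠ 0 ∧ |w| ≤ 2 * (n : ℤ)} →
            lieZ1 K (orthPiDerived K n) (orthPiDerived K n))
        (b : Module.Basis {w : ℤ // Even w ∧ w ≠ 0 ∧ |w| ≤ 2 * (n : ℤ)} K
            (lieH1 K (orthPiDerived K n) (orthPiDerived K n))),
        ∀ w, CochainHasWeight (c w : oneCochain K (orthPiDerived K n) (orthPiDerived K n)) w ∧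
          b w = lieH1Mk K (orthPiDerived K n) (orthPiDerived K n) (c w)) ∧
    -- the center of `𝔬_Π(2n+1)` consists of the scalar matrices
    (∀ X : orthPi K n, X ∈ LieAlgebra.center K (orthPi K n) ↔
      ∃ t : K, (X : Matrix (PiIndex n) (PiIndex n) K) = t • 1) ∧
    -- all derivations of `𝔤`: `𝔬_Π(2n+1)` modulo scalars, acting by the commutator
    (∃ e : (orthPi K n ⧸ LieAlgebra.center K (orthPi K n)) ≃ₗ⁅K⁆
        LieDerivation K (orthPiDerived K n) (orthPiDerived K n),
      ∀ (X : orthPi K n) (y : orthPiDerived K n),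
        e (LieSubmodule.Quotient.mk' (LieAlgebra.center K (orthPi K n)) X) y = ⁅X, y⁆) := by
  refine ⟨⟨?_, fun w => LieDerivation.toCocycle ((orthPiDerived K n).actionDerivation
    (piSingle K (outerLabel ((outerWeightEquiv n).symm w)))),
    (orthPiH1Basis K n).reindex (outerWeightEquiv n), fun w => ⟨?_, ?_⟩⟩,
    mem_center_orthPi_iff,
    (orthPiDerived K n).quotientCenterEquivDerivation lie_orthPiDerived_eq_zero_iff
      exists_orthPi_derivation_eq_lie,
    (orthPiDerived K n).quotientCenterEquivDerivation_mk lie_orthPiDerived_eq_zero_iff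
      exists_orthPi_derivation_eq_lie⟩
  · rw [Module.finrank_eq_card_basis (orthPiH1Basis K n), Fintype.card_sum, Fintype.card_fin,
      two_mul]
  · refine cochainHasWeight_toCocycle ?_
    have h := piHomogeneous_piSingle (K := K) (outerLabel ((outerWeightEquiv n).symm w))
    rwa [← coe_outerWeightEquiv, Equiv.apply_symm_apply] at h
  · exact ((orthPiH1Basis K n).reindex_apply (outerWeightEquiv n) w).trans
      (orthPiH1Basis_apply ((outerWeightEquiv n).symm w))
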